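/- Let $\mathcal L$ be the set of sentences of a propositional language with connectives $\neg,\wedge,\vee,\to,\leftrightarrow$ (over an arbitrary set of atoms), and let $Cn$ be a consequence operation on subsets of $\mathcal L$ that satisfies inclusion ($A\subseteq Cn(A)$), monotony ($A\subseteq B$ implies $Cn(A)\subseteq Cn(B)$), iteration ($Cn(Cn(A))=Cn(A)$), supraclassicality (every classical truth-functional consequence of $A$ is in $Cn(A)$), compactness (if $\alpha\in Cn(A)$ then $\alpha\in Cn(B)$ for some finite $B\subseteq A$) and deduction (if $\beta\in Cn(A\cup\{\alpha\})$ then $(\alpha\to\beta)\in Cn(A)$). Write $\vdash\alpha$ for $\alpha\in Cn(\emptyset)$, $Cn(\alpha)$ for $Cn(\{\alpha\})$ and $A+\alpha$ for $Cn(A\cup\{\alpha\})$; $A$ is consistent if $Cn(A)$ contains no contradiction, and a sentence $\alpha$ is consistent if $\{\alpha\}$ is. A possible world is a maximal consistent subset of $\mathcal L$; for $R\subseteq\mathcal L$, $\|R\|$ is the set of worlds that include $R$, and $\|\alpha\|=\|Cn(\alpha)\|$. For a set $X$ of worlds, $\bigcap X$ is the set of sentences that belong to every world in $X$. Let $K\subseteq\mathcal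 L$ be consistent with $K=Cn(K)$, and let $\odot$ be an operator on $K$, i.e. a function assigning to every sentence $\alpha$ a set $K\odot\alpha\subseteq\mathcal L$. Then the following conditions are equivalent. (1) For all sentences $\alpha,\beta$: - weak relative success: $\alpha\in K\odot\alpha$ or $K\odot\alpha\subseteq K$; - closure: $K\odot\alpha=Cn(K\odot\alpha)$; - inclusion: $K\odot\alpha\subseteq K+\alpha$; - consistency preservation: if $K$ is consistent, then $K\odot\alpha$ is consistent; - vacuity: if $\neg\alpha\notin K$, then $K+\alpha\subseteq K\odot\alpha$; - extensionality: if $\vdash\alpha\leftrightarrow\beta$, then $K\odot\alpha=K\odot\beta$; - strict improvement: if $\alpha\in K\odot\alpha$ and $\vdash\alpha\to\beta$, then $\beta\in K\odot\beta$; - N-persistence: if $\neg\beta\in K\odot\beta$, then $\neg\beta\in K\odot\alpha$; - N-recovery: $K\subseteq (K\odot\alpha)+\neg\alpha$; - disjunctive overlap: $(K\odot\alpha)\cap(K\odot\beta)\subseteq K\odot(\alpha\vee\beta)$; - disjunctive inclusion: if $\neg\alpha\notin K\odot(\alpha\vee\beta)$, then $K\odot(\alpha\vee\beta)\subseteq K\odot\alpha$.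 (2) $\odot$ is a system of spheres-based two level CL (credibility-limited) revision operator, that is: there are sets $\mathbb S_i\subseteq\mathbb S$ of sets of worlds such that (a) each $\mathbb T\in\{\mathbb S_i,\mathbb S\}$ is totally ordered by inclusion, has $\|K\|$ as its $\subseteq$-minimum, and for every sentence $\alpha$, if some element of $\mathbb T$ intersects $\|\alpha\|$, then there is a smallest element of $\mathbb T$ intersecting $\|\alpha\|$; (b) if $X\in\mathbb S_i$ and $Y\in\mathbb S\setminus\mathbb S_i$, then $X\subseteq Y$; and for every sentence $\alpha$, with $S_\alpha$ the smallest element of $\mathbb S$ that intersects $\|\alpha\|$ (if any element does): $$K\odot\alpha=\begin{cases}\bigcap(S_\alpha\cap\|\alpha\|) & \text{if } S_\alpha\in\mathbb S_i,\\ \bigcap\bigl(\|K\|\cup(S_\alpha\cap\|\alpha\|)\bigr) & \text{if } S_\alpha\in\mathbb S\setminus\mathbb S_i,\\ K & \text{if } X\cap\|\alpha\|=\emptyset\text{ for all }X\in\mathbb S.\end{cases}$$ (3) $\odot$ is a two level CL revision operator induced by an AGM revision $\star$ for $K$ and sets $C_H,C_L\subseteq\mathcal L$, that is, $$K\odot\alpha=\begin{cases}K\star\alpha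 & \text{if }\alpha\in C_H,\\ (K\star\alpha)\cap K & \text{if }\alpha\in C_L,\\ K & \text{if }\alpha\notin C_L\cup C_H,\end{cases}$$ such that: - $\star$ satisfies, for all $\alpha,\beta$, closure, inclusion, vacuity, extensionality, disjunctive overlap and disjunctive inclusion (as in (1), with $\star$ in place of $\odot$), success ($\alpha\in K\star\alpha$) and consistency (if $\alpha$ is consistent, then $K\star\alpha$ is consistent); - $C_L$ satisfies credibility of logical equivalents (if $\vdash\alpha\leftrightarrow\beta$, then $\alpha\in C_L$ iff $\beta\in C_L$) and element consistency (every $\alpha\in C_L$ is consistent); - $C_H\cap C_L=\emptyset$; - $C_H$ satisfies element consistency, credibility lower bounding (if $K$ is consistent, then $K\subseteq C_H$) and single sentence closure (if $\alpha\in C_H$, then $Cn(\alpha)\subseteq C_H$); - condition $(C_H\cup C_L\,$-$\,\star)$: if $\alpha\notin C_H\cup C_L$ and $\beta\in C_H\cup C_L$, then $\neg\alpha\in K\star\beta$; - condition $(C_H\,$-$\,\star)$: if $\alpha\notin C_H$ and $\beta\in C_H$, then $\neg\alpha\in K\star\beta$. -/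

import Mathlib

namespace BeliefRevision

/-- Sentences built by the usual truth functional connectives from an arbitrary type of atoms
(any sentence that is not a Boolean compound counts as an atom). -/
inductive Form (Atom : Type*) : Type _
  | atom : Atom → Form Atom
  | neg : Form Atom → Form Atom
  | and : Form Atom → Form Atom → Form Atom
  | or : Form Atom → Form Atom → Form Atom
  | imp : Form Atom → Form Atom → Form Atom
  | iff : Form Atom → Form Atom → Form Atom

namespace Form

/-- Truth of a sentence under a valuation of the atoms. -/
def Holds {Atom : Type*} (v : Atom → Prop) : Form Atom → Prop
  | atom p => v p
  | neg a => ¬ Holds v a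
  | and a b => Holds v a ∧ Holds v b
  | or a b => Holds v a ∨ Holds v b
  | imp a b => Holds v a → Holds v b
  | iff a b => (Holds v a ↔ Holds v b)

/-- A (truth functional) contradiction: false under every valuation. -/
def IsContradiction {Atom : Type*} (a : Form Atom) : Prop :=
  ∀ v : Atom → Prop, ¬ Holds v a

end Form

/-- Classical truth functional consequence. -/
def ClassicallyEntails {Atom : Type*} (A : Set (Form Atom)) (a : Form Atom) : Prop :=
  ∀ v : Atom → Prop, (∀ b ∈ A, Form.Holds v b) → Form.Holds v a

/-- A Tarskian consequence operation that is supraclassical, compact and satisfies deduction. -/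
structure IsConsequence {Atom : Type*} (Cn : Set (Form Atom) → Set (Form Atom)) : Prop where
  inclusion : ∀ A, A ⊆ Cn A
  monotony : ∀ A B, A ⊆ B → Cn A ⊆ Cn B
  iteration : ∀ A, Cn (Cn A) = Cn A
  supraclassicality : ∀ A a, ClassicallyEntails A a → a ∈ Cn A
  compactness : ∀ A a, a ∈ Cn A → ∃ B ⊆ A, B.Finite ∧ a ∈ Cn B
  deduction : ∀ A a b, b ∈ Cn (A ∪ {a}) → Form.imp a b ∈ Cn A

section Notions

variable {Atom : Type*} (Cn : Set (Form Atom) → Set (Form Atom))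

/-- No contradiction is a consequence of `A`. -/
def Consistent (A : Set (Form Atom)) : Prop :=
  ∀ c : Form Atom, c.IsContradiction → c ∉ Cn A

/-- The expansion `A + a`. -/
def expand (A : Set (Form Atom)) (a : Form Atom) : Set (Form Atom) :=
  Cn (A ∪ {a})

/-- `⊢ a`. -/
def Thm (a : Form Atom) : Prop := a ∈ Cn ∅

/-! Postulates for an operator on a belief set `K`. The operator is given as the function
`rev` that sends a sentence `a` to the outcome of changing `K` by `a`. -/

def Closure (rev : Form Atom → Set (Form Atom)) : Prop :=
  ∀ a, rev a = Cn (rev a)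

def Success (rev : Form Atom → Set (Form Atom)) : Prop :=
  ∀ a, a ∈ rev a

def Inclusion (K : Set (Form Atom)) (rev : Form Atom → Set (Form Atom)) : Prop :=
  ∀ a, rev a ⊆ expand Cn K a

def Vacuity (K : Set (Form Atom)) (rev : Form Atom → Set (Form Atom)) : Prop :=
  ∀ a, Form.neg a ∉ K → expand Cn K a ⊆ rev a

/-- The AGM postulate of consistency. -/
def ConsistencyAGM (rev : Form Atom → Set (Form Atom)) : Prop :=
  ∀ a, Consistent Cn {a} → Consistent Cn (rev a)

def Extensionality (rev : Form Atom → Set (Form Atom)) : Prop :=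
  ∀ a b, Thm Cn (Form.iff a b) → rev a = rev b

def DisjunctiveOverlap (rev : Form Atom → Set (Form Atom)) : Prop :=
  ∀ a b, rev a ∩ rev b ⊆ rev (Form.or a b)

def DisjunctiveInclusion (rev : Form Atom → Set (Form Atom)) : Prop :=
  ∀ a b, Form.neg a ∉ rev (Form.or a b) → rev (Form.or a b) ⊆ rev a

def ConsistencyPreservation (K : Set (Form Atom)) (rev : Form Atom → Set (Form Atom)) : Prop :=
  Consistent Cn K → ∀ a, Consistent Cn (rev a)

def StrictImprovement (rev : Form Atom → Set (Form Atom)) : Prop :=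
  ∀ a b, a ∈ rev a → Thm Cn (Form.imp a b) → b ∈ rev b

def NRecovery (K : Set (Form Atom)) (rev : Form Atom → Set (Form Atom)) : Prop :=
  ∀ a, K ⊆ expand Cn (rev a) (Form.neg a)

def NPersistence (rev : Form Atom → Set (Form Atom)) : Prop :=
  ∀ a b, Form.neg b ∈ rev b → Form.neg b ∈ rev a

def WeakRelativeSuccess (K : Set (Form Atom)) (rev : Form Atom → Set (Form Atom)) : Prop :=
  ∀ a, a ∈ rev a ∨ rev a ⊆ K

structure IsBasicAGMRevision (K : Set (Form Atom)) (star : Form Atom → Set (Form Atom)) :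
    Prop where
  closure : Closure Cn star
  success : Success star
  inclusion : Inclusion Cn K star
  vacuity : Vacuity Cn K star
  consistency : ConsistencyAGM Cn star
  extensionality : Extensionality Cn star

structure IsAGMRevision (K : Set (Form Atom)) (star : Form Atom → Set (Form Atom)) : Prop
    extends IsBasicAGMRevision Cn K star where
  disjunctiveOverlap : DisjunctiveOverlap star
  disjunctiveInclusion : DisjunctiveInclusion star

/-! Properties of a set `C` of credible sentences. -/

def CredibilityOfLogicalEquivalents (C : Set (Form Atom)) : Prop :=
  ∀ a b, Thm Cn (Form.iff a b) → (a ∈ C ↔ b ∈ C)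

def SingleSentenceClosure (C : Set (Form Atom)) : Prop :=
  ∀ a ∈ C, Cn {a} ⊆ C

def ElementConsistency (C : Set (Form Atom)) : Prop :=
  ∀ a ∈ C, Consistent Cn {a}

def CredibilityLowerBounding (K C : Set (Form Atom)) : Prop :=
  Consistent Cn K → K ⊆ C

/-- The condition `(C - ⋆)`. -/
def CredStar (C : Set (Form Atom)) (star : Form Atom → Set (Form Atom)) : Prop :=
  ∀ a b, a ∉ C → b ∈ C → Form.neg a ∈ star b

/-- `rev` is the two level CL revision operator on `K` induced by the basic AGM revision `star`
and the sets `CH`, `CL`. -/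
structure IsTwoLevelCLRevision (K : Set (Form Atom)) (star : Form Atom → Set (Form Atom))
    (CH CL : Set (Form Atom)) (rev : Form Atom → Set (Form Atom)) : Prop where
  basic : IsBasicAGMRevision Cn K star
  high : ∀ a ∈ CH, rev a = star a
  low : ∀ a ∈ CL, rev a = star a ∩ K
  none : ∀ a, a ∉ CL ∪ CH → rev a = K

/-- Possible worlds: the maximal consistent sets of sentences. -/
def World : Type _ := {M : Set (Form Atom) // Maximal (Consistent Cn) M}

/-- `‖R‖`, the set of worlds that contain `R`. -/
def worldsOf (R : Set (Form Atom)) : Set (World Cn) := {M | R ⊆ M.1}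

/-- `‖a‖`, the set of `a`-worlds. -/
def worldsOfForm (a : Form Atom) : Set (World Cn) := worldsOf Cn (Cn {a})

variable {Cn} in
/-- `⋂ X`, the set of sentences that belong to every world in `X`. -/
def theoryOf (X : Set (World Cn)) : Set (Form Atom) := {a | ∀ M ∈ X, a ∈ M.1}

/-- `X` is the smallest sphere of `S` that intersects `‖a‖`. -/
def IsSmallestSphere (S : Set (Set (World Cn))) (a : Form Atom) (X : Set (World Cn)) : Prop :=
  IsLeast {Y | Y ∈ S ∧ (Y ∩ worldsOfForm Cn a).Nonempty} X

/-- A system of spheres centred on `‖K‖`, not required to contain the set of all worlds. -/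
structure IsSphereSystem (K : Set (Form Atom)) (S : Set (Set (World Cn))) : Prop where
  total : ∀ U ∈ S, ∀ V ∈ S, U ⊆ V ∨ V ⊆ U
  centre_mem : worldsOf Cn K ∈ S
  centre_subset : ∀ U ∈ S, worldsOf Cn K ⊆ U
  smallest : ∀ a : Form Atom, (∃ U ∈ S, (U ∩ worldsOfForm Cn a).Nonempty) →
    ∃ X, IsSmallestSphere Cn S a X

/-- A two level system of spheres `(Si, S)` centred on `‖K‖`. -/
structure IsTwoLevelSphereSystem (K : Set (Form Atom)) (Si S : Set (Set (World Cn))) :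
    Prop where
  inner : IsSphereSystem Cn K Si
  outer : IsSphereSystem Cn K S
  subset : Si ⊆ S
  innermost : ∀ X ∈ Si, ∀ Y ∈ S \ Si, X ⊆ Y

/-- `rev` is the operator on `K` induced by the two level system of spheres `(Si, S)`. -/
structure IsInducedBySpheres (K : Set (Form Atom)) (Si S : Set (Set (World Cn)))
    (rev : Form Atom → Set (Form Atom)) : Prop where
  high : ∀ a X, IsSmallestSphere Cn S a X → X ∈ Si →
    rev a = theoryOf (X ∩ worldsOfForm Cn a)
  low : ∀ a X, IsSmallestSphere Cn S a X → X ∈ S \ Si →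
    rev a = theoryOf (worldsOf Cn K ∪ (X ∩ worldsOfForm Cn a))
  none : ∀ a, (∀ X ∈ S, X ∩ worldsOfForm Cn a = ∅) → rev a = K

/-- `rev` is a system of spheres-based two level CL revision operator on `K`. -/
def IsSphereBasedTwoLevelCLRevision (K : Set (Form Atom)) (rev : Form Atom → Set (Form Atom)) :
    Prop :=
  ∃ Si S : Set (Set (World Cn)),
    IsTwoLevelSphereSystem Cn K Si S ∧ IsInducedBySpheres Cn K Si S rev

end Notions

end BeliefRevision

/-!
All three conditions say that `rev` is governed by a choice function on possible worlds
(`IsTwoLevelChoice`): every sentence `a` is assigned a set `F a ⊆ ‖a‖` of most plausible worlds,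
empty if `a` is not credible, and some credible sentences form the set `H` of high credibility. The
axioms are those of rational choice. If `‖a‖ ⊆ ‖b‖` and some best `b`-world is an `a`-world, then
the best `a`-worlds are exactly the best `b`-worlds in `‖a‖`; credibility and high credibility pass
to weaker sentences; and high credibility passes down to `a` in the first situation. Each condition
is shown to be equivalent to the existence of such `F` and `H`.

From the postulates, `F a = ‖rev a‖ ∩ ‖a‖` and `H = {a | a ∈ rev a}`. The main point is a form of
superexpansion: `x ∈ rev a` implies `(a → x) ∈ rev b` for `b` weaker than `a`. It comes from
disjunctive overlap applied to `a` and `b ∧ ¬a`, where N-recovery supplies what success supplies in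
the AGM setting.

From spheres, `F a` is the part of `‖a‖` in the smallest sphere that meets it. Conversely, Grove's
sphere of a credible `a` is the union of the `F b` over all `b` weaker than `a`; it meets `‖a‖`
exactly in `F a` and lies inside every other sphere that meets `‖a‖`
(`sphere_inter`, `sphere_subset_of_meets`).

From an AGM revision, `F a` is the set of worlds of the revised theory for credible `a`, and the two
conditions linking credibility to the revision are what makes `F` and `H` coherent. Conversely, the
choice function is made total by choosing all of `‖a‖` when `a` is not credible (`totalChoice`).

Truth in a set of worlds is tied to `Cn` by Lindenbaum's lemma, in the form of `mem_Cn_iff`.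
-/

namespace BeliefRevision

variable {Atom : Type*} {Cn : Set (Form Atom) → Set (Form Atom)}

/-! ### Possible worlds -/

theorem IsConsequence.mem_of_entails (hCn : IsConsequence Cn) {A B : Set (Form Atom)}
    {a : Form Atom} (hB : B ⊆ Cn A) (h : ClassicallyEntails B a) : a ∈ Cn A := by
  rw [← hCn.iteration A]
  exact hCn.monotony _ _ hB (hCn.supraclassicality _ _ h)

theorem Consistent.mono (hCn : IsConsequence Cn) {A B : Set (Form Atom)} (h : A ⊆ B)
    (hB : Consistent Cn B) : Consistent Cn A :=
  fun c hc hcA => hB c hc (hCn.monotony _ _ h hcA)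

/-- Lindenbaum's lemma. -/
theorem Consistent.exists_world (hCn : IsConsequence Cn) {A : Set (Form Atom)}
    (hA : Consistent Cn A) : ∃ M : World Cn, A ⊆ M.1 := by
  obtain ⟨M, hAM, hM⟩ := zorn_subset_nonempty {B | Consistent Cn B} (by
    intro c hc hchain hne
    refine ⟨⋃₀ c, ?_, fun s hs => Set.subset_sUnion_of_mem hs⟩
    intro d hd hdc
    obtain ⟨B, hB, hfin, hdB⟩ := hCn.compactness _ _ hdc
    obtain ⟨t, ht, hBt⟩ := hchain.directedOn.exists_mem_subset_of_finite_of_subset_sUnion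
      hne hfin hB
    exact hc ht d hd (hCn.monotony _ _ hBt hdB)) A hA
  exact ⟨⟨M, hM⟩, hAM⟩

theorem World.cn_subset (hCn : IsConsequence Cn) (M : World Cn) : Cn M.1 ⊆ M.1 := by
  refine M.2.2 ?_ (hCn.inclusion _)
  intro c hc
  rw [hCn.iteration]
  exact M.2.1 c hc

theorem World.mem_of_entails (hCn : IsConsequence Cn) (M : World Cn) {B : Set (Form Atom)}
    {a : Form Atom} (hB : B ⊆ M.1) (h : ClassicallyEntails B a) : a ∈ M.1 :=
  M.cn_subset hCn (hCn.mem_of_entails (hB.trans (hCn.inclusion _)) h)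

theorem World.neg_mem_iff (hCn : IsConsequence Cn) (M : World Cn) {a : Form Atom} :
    Form.neg a ∈ M.1 ↔ a ∉ M.1 := by
  constructor
  · intro hn ha
    refine M.2.1 (Form.and a (Form.neg a)) (fun v h => h.2 h.1) ?_
    refine hCn.supraclassicality _ _ fun v h => ⟨h _ ha, h _ hn⟩
  · intro ha
    have hinc : ¬ Consistent Cn (M.1 ∪ {a}) := fun h =>
      ha (M.2.2 h Set.subset_union_left (Or.inr rfl))
    simp only [Consistent, not_forall, not_not] at hinc
    obtain ⟨c, hc, hca⟩ := hinc
    refine M.mem_of_entails hCn (B := {Form.imp a c})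
      (Set.singleton_subset_iff.2 (M.cn_subset hCn (hCn.deduction _ _ _ hca))) ?_
    exact fun v h ha => hc v (h _ rfl ha)

theorem World.or_mem_iff (hCn : IsConsequence Cn) (M : World Cn) {a b : Form Atom} :
    Form.or a b ∈ M.1 ↔ a ∈ M.1 ∨ b ∈ M.1 := by
  constructor
  · intro h
    by_contra! hab
    rw [← M.neg_mem_iff hCn, ← M.neg_mem_iff hCn] at hab
    refine (M.neg_mem_iff hCn).1 ?_ h
    refine M.mem_of_entails hCn (B := {Form.neg a, Form.neg b}) ?_ ?_
    · rintro x (rfl | rfl)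
      exacts [hab.1, hab.2]
    · rintro v hv (h | h)
      exacts [hv (Form.neg a) (by simp) h, hv (Form.neg b) (by simp) h]
  · rintro (h | h)
    · exact M.mem_of_entails hCn (Set.singleton_subset_iff.2 h) fun v hv => Or.inl (hv _ rfl)
    · exact M.mem_of_entails hCn (Set.singleton_subset_iff.2 h) fun v hv => Or.inr (hv _ rfl)

theorem World.imp_mem_iff (hCn : IsConsequence Cn) (M : World Cn) {a b : Form Atom} :
    Form.imp a b ∈ M.1 ↔ (a ∈ M.1 → b ∈ M.1) := by
  constructor
  · intro h ha
    refine M.mem_of_entails hCn (B := {Form.imp a b, a}) ?_ ?_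
    · rintro x (rfl | rfl)
      exacts [h, ha]
    · exact fun v hv => hv (Form.imp a b) (by simp) (hv a (by simp))
  · intro h
    by_cases ha : a ∈ M.1
    · exact M.mem_of_entails hCn (Set.singleton_subset_iff.2 (h ha)) fun v hv _ => hv _ rfl
    · rw [← M.neg_mem_iff hCn] at ha
      exact M.mem_of_entails hCn (Set.singleton_subset_iff.2 ha)
        fun v hv hx => absurd hx (hv _ rfl)

/-- The worlds are complete for `Cn`. -/
theorem mem_Cn_iff (hCn : IsConsequence Cn) {A : Set (Form Atom)} {a : Form Atom} :
    a ∈ Cn A ↔ ∀ M : World Cn, A ⊆ M.1 → a ∈ M.1 := by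
  refine ⟨fun h M hM => M.cn_subset hCn (hCn.monotony _ _ hM h), fun h => ?_⟩
  by_contra ha
  have hcons : Consistent Cn (A ∪ {Form.neg a}) := by
    intro c hc hca
    refine ha (hCn.mem_of_entails (B := {Form.imp (Form.neg a) c})
      (Set.singleton_subset_iff.2 (hCn.deduction _ _ _ hca)) ?_)
    intro v hv
    by_contra hva
    exact hc v (hv _ rfl hva)
  obtain ⟨M, hM⟩ := hcons.exists_world hCn
  exact (M.neg_mem_iff hCn).1 (hM (Or.inr rfl)) (h M (Set.subset_union_left.trans hM))

theorem mem_expand_iff (hCn : IsConsequence Cn) {A : Set (Form Atom)} {a x : Form Atom} :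
    x ∈ expand Cn A a ↔ ∀ M : World Cn, A ⊆ M.1 → a ∈ M.1 → x ∈ M.1 := by
  simp only [expand, mem_Cn_iff hCn, Set.union_subset_iff, Set.singleton_subset_iff, and_imp]

theorem mem_worldsOfForm (hCn : IsConsequence Cn) {a : Form Atom} {M : World Cn} :
    M ∈ worldsOfForm Cn a ↔ a ∈ M.1 :=
  ⟨fun h => h (hCn.inclusion _ rfl), fun h _ hx =>
    (mem_Cn_iff hCn).1 hx M (Set.singleton_subset_iff.2 h)⟩

theorem thm_imp_iff (hCn : IsConsequence Cn) {a b : Form Atom} :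
    Thm Cn (Form.imp a b) ↔ worldsOfForm Cn a ⊆ worldsOfForm Cn b := by
  simp only [Thm, mem_Cn_iff hCn, Set.empty_subset, true_imp_iff, World.imp_mem_iff hCn]
  exact forall_congr' fun M => by rw [mem_worldsOfForm hCn, mem_worldsOfForm hCn]

theorem mem_Cn_singleton_iff (hCn : IsConsequence Cn) {a b : Form Atom} :
    b ∈ Cn {a} ↔ worldsOfForm Cn a ⊆ worldsOfForm Cn b := by
  simp only [mem_Cn_iff hCn, Set.singleton_subset_iff]
  exact forall_congr' fun M => by rw [mem_worldsOfForm hCn, mem_worldsOfForm hCn]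

theorem thm_iff_iff (hCn : IsConsequence Cn) {a b : Form Atom} :
    Thm Cn (Form.iff a b) ↔ worldsOfForm Cn a = worldsOfForm Cn b := by
  rw [Set.Subset.antisymm_iff, ← thm_imp_iff hCn, ← thm_imp_iff hCn]
  refine ⟨fun h => ⟨?_, ?_⟩, fun h => ?_⟩
  · exact hCn.mem_of_entails (Set.singleton_subset_iff.2 h) fun v hv => (hv _ rfl).1
  · exact hCn.mem_of_entails (Set.singleton_subset_iff.2 h) fun v hv => (hv _ rfl).2
  · refine hCn.mem_of_entails (B := {Form.imp a b, Form.imp b a}) ?_ ?_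
    · rintro x (rfl | rfl)
      exacts [h.1, h.2]
    · exact fun v hv => ⟨hv (Form.imp a b) (by simp), hv (Form.imp b a) (by simp)⟩

theorem worldsOfForm_or (hCn : IsConsequence Cn) (a b : Form Atom) :
    worldsOfForm Cn (Form.or a b) = worldsOfForm Cn a ∪ worldsOfForm Cn b := by
  ext M
  simp only [Set.mem_union, mem_worldsOfForm hCn, M.or_mem_iff hCn]

theorem worldsOfForm_subset_or_left (hCn : IsConsequence Cn) (a b : Form Atom) :
    worldsOfForm Cn a ⊆ worldsOfForm Cn (Form.or a b) :=
  worldsOfForm_or hCn a b ▸ Set.subset_union_left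

theorem worldsOfForm_subset_or_right (hCn : IsConsequence Cn) (a b : Form Atom) :
    worldsOfForm Cn b ⊆ worldsOfForm Cn (Form.or a b) :=
  worldsOfForm_or hCn a b ▸ Set.subset_union_right

/-- If `b` is weaker than `a`, then `b` is equivalent to `a ∨ c` with `c` incompatible with `a`;
the witness expresses `b ∧ ¬a`. -/
theorem exists_diff (hCn : IsConsequence Cn) {a b : Form Atom}
    (hab : worldsOfForm Cn a ⊆ worldsOfForm Cn b) :
    ∃ c, (∀ M : World Cn, c ∈ M.1 → a ∉ M.1) ∧
      worldsOfForm Cn (Form.or a c) = worldsOfForm Cn b := by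
  have hcM : ∀ M : World Cn, Form.neg (Form.or a (Form.neg b)) ∈ M.1 ↔ a ∉ M.1 ∧ b ∈ M.1 :=
    fun M => by rw [M.neg_mem_iff hCn, M.or_mem_iff hCn, M.neg_mem_iff hCn]; tauto
  refine ⟨_, fun M hM => ((hcM M).1 hM).1, ?_⟩
  ext M
  have := @hab M
  simp only [mem_worldsOfForm hCn] at this
  rw [mem_worldsOfForm hCn, mem_worldsOfForm hCn, M.or_mem_iff hCn, hcM]
  tauto

theorem consistent_iff_nonempty (hCn : IsConsequence Cn) {A : Set (Form Atom)} :
    Consistent Cn A ↔ (worldsOf Cn A).Nonempty :=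
  ⟨fun h => h.exists_world hCn, fun ⟨M, hM⟩ => Consistent.mono hCn hM M.2.1⟩

theorem consistent_singleton_iff (hCn : IsConsequence Cn) {a : Form Atom} :
    Consistent Cn {a} ↔ (worldsOfForm Cn a).Nonempty := by
  rw [consistent_iff_nonempty hCn]
  exact exists_congr fun M => by
    rw [mem_worldsOfForm hCn]; exact Set.singleton_subset_iff

theorem theoryOf_closed (hCn : IsConsequence Cn) (X : Set (World Cn)) :
    theoryOf X = Cn (theoryOf X) :=
  Set.Subset.antisymm (hCn.inclusion _) fun _ hx M hM =>
    (mem_Cn_iff hCn).1 hx M fun _ hy => hy M hM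

theorem theoryOf_worldsOf (hCn : IsConsequence Cn) {A : Set (Form Atom)} (hA : A = Cn A) :
    theoryOf (worldsOf Cn A) = A := by
  ext x
  conv_rhs => rw [hA]
  exact (mem_Cn_iff hCn).symm

theorem theoryOf_union (X Y : Set (World Cn)) :
    theoryOf (X ∪ Y) = theoryOf X ∩ theoryOf Y :=
  Set.ext fun _ => ⟨fun h => ⟨fun M hM => h M (Or.inl hM), fun M hM => h M (Or.inr hM)⟩,
    fun h M hM => hM.elim (h.1 M) (h.2 M)⟩

theorem theoryOf_consistent (hCn : IsConsequence Cn) {X : Set (World Cn)} (hX : X.Nonempty) :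
    Consistent Cn (theoryOf X) := by
  obtain ⟨M, hM⟩ := hX
  exact (consistent_iff_nonempty hCn).2 ⟨M, fun _ hx => hx M hM⟩

theorem neg_notMem_theoryOf_iff (hCn : IsConsequence Cn) {X : Set (World Cn)} {a : Form Atom} :
    Form.neg a ∉ theoryOf X ↔ (X ∩ worldsOfForm Cn a).Nonempty := by
  simp only [theoryOf, Set.mem_ofPred_eq, World.neg_mem_iff hCn, Set.Nonempty, Set.mem_inter_iff,
    mem_worldsOfForm hCn]
  push Not
  rfl

theorem neg_notMem_iff (hCn : IsConsequence Cn) {A : Set (Form Atom)} (hA : A = Cn A)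
    {a : Form Atom} :
    Form.neg a ∉ A ↔ (worldsOf Cn A ∩ worldsOfForm Cn a).Nonempty := by
  rw [← neg_notMem_theoryOf_iff hCn, theoryOf_worldsOf hCn hA]

/-! ### Credibility-limited choice functions -/

/-- A two level choice function on worlds centred on `‖K‖`, together with the operator `rev` it
induces. `F a` is the set of most plausible `a`-worlds, empty exactly when `a` is not credible, and
`H` is the set of sentences of high credibility. Monotonicity is expressed through `‖a‖ ⊆ ‖b‖`, so
`F` and `H` automatically respect logical equivalence. The sentences of low credibility and those
that are not credible share the field `rev_low`, since `‖K‖ ∪ F a` is just `‖K‖` if `F a = ∅`. -/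
structure IsTwoLevelChoice (Cn : Set (Form Atom) → Set (Form Atom)) (K : Set (Form Atom))
    (rev : Form Atom → Set (Form Atom)) (F : Form Atom → Set (World Cn))
    (H : Set (Form Atom)) : Prop where
  subset : ∀ a, F a ⊆ worldsOfForm Cn a
  nonempty_mono : ∀ a b, worldsOfForm Cn a ⊆ worldsOfForm Cn b → (F a).Nonempty → (F b).Nonempty
  restrict : ∀ a b, worldsOfForm Cn a ⊆ worldsOfForm Cn b →
    (F b ∩ worldsOfForm Cn a).Nonempty → F a = F b ∩ worldsOfForm Cn a
  high_nonempty : ∀ a ∈ H, (F a).Nonempty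
  high_mono : ∀ a b, worldsOfForm Cn a ⊆ worldsOfForm Cn b → a ∈ H → b ∈ H
  high_restrict : ∀ a b, worldsOfForm Cn a ⊆ worldsOfForm Cn b →
    (F b ∩ worldsOfForm Cn a).Nonempty → b ∈ H → a ∈ H
  centre : ∀ a, (worldsOf Cn K ∩ worldsOfForm Cn a).Nonempty →
    F a = worldsOf Cn K ∩ worldsOfForm Cn a
  centre_high : ∀ a, (worldsOf Cn K ∩ worldsOfForm Cn a).Nonempty → a ∈ H
  rev_high : ∀ a ∈ H, rev a = theoryOf (F a)
  rev_low : ∀ a, a ∉ H → rev a = theoryOf (worldsOf Cn K ∪ F a)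

namespace IsTwoLevelChoice

variable {K : Set (Form Atom)} {rev : Form Atom → Set (Form Atom)}
  {F : Form Atom → Set (World Cn)} {H : Set (Form Atom)}

theorem congr (h : IsTwoLevelChoice Cn K rev F H) {a b : Form Atom}
    (hab : worldsOfForm Cn a = worldsOfForm Cn b) : F a = F b := by
  rcases (F b).eq_empty_or_nonempty with hb | hb
  · rw [hb, ← Set.not_nonempty_iff_eq_empty]
    exact fun ha => (h.nonempty_mono a b hab.subset ha).ne_empty hb
  · have : F b ∩ worldsOfForm Cn a = F b := Set.inter_eq_left.2 (hab ▸ h.subset b)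
    rw [h.restrict a b hab.subset (this.symm ▸ hb), this]

theorem high_congr (h : IsTwoLevelChoice Cn K rev F H) {a b : Form Atom}
    (hab : worldsOfForm Cn a = worldsOfForm Cn b) : a ∈ H ↔ b ∈ H :=
  ⟨h.high_mono a b hab.subset, h.high_mono b a hab.superset⟩

theorem meets_or (h : IsTwoLevelChoice Cn K rev F H) (hCn : IsConsequence Cn) (a b : Form Atom)
    (hab : (F (Form.or a b)).Nonempty) :
    (F (Form.or a b) ∩ worldsOfForm Cn a).Nonempty ∨
      (F (Form.or a b) ∩ worldsOfForm Cn b).Nonempty := by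
  obtain ⟨M, hM⟩ := hab
  have := h.subset _ hM
  rw [worldsOfForm_or hCn] at this
  exact this.imp (fun h => ⟨M, hM, h⟩) (fun h => ⟨M, hM, h⟩)

/-- If some best `b`-world satisfies `a`, then `a` is at least as plausible as `b`: some best
`a ∨ b`-world satisfies `a`. -/
theorem or_meets_left (h : IsTwoLevelChoice Cn K rev F H) (hCn : IsConsequence Cn)
    {a b : Form Atom} (hab : (F b ∩ worldsOfForm Cn a).Nonempty) :
    (F (Form.or a b) ∩ worldsOfForm Cn a).Nonempty := by
  rcases h.meets_or hCn a b
    (h.nonempty_mono b _ (worldsOfForm_subset_or_right hCn a b) hab.left) with h' | h'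
  · exact h'
  · rw [h.restrict b _ (worldsOfForm_subset_or_right hCn a b) h'] at hab
    exact hab.mono fun M hM => ⟨hM.1.1, hM.2⟩

theorem nonempty_of_meets (h : IsTwoLevelChoice Cn K rev F H) (hCn : IsConsequence Cn)
    {a b : Form Atom} (hab : (F b ∩ worldsOfForm Cn a).Nonempty) : (F a).Nonempty := by
  have h' := h.or_meets_left hCn hab
  rwa [h.restrict a _ (worldsOfForm_subset_or_left hCn a b) h']

theorem high_of_meets (h : IsTwoLevelChoice Cn K rev F H) (hCn : IsConsequence Cn)
    {a b : Form Atom} (hb : b ∈ H) (hab : (F b ∩ worldsOfForm Cn a).Nonempty) : a ∈ H :=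
  h.high_restrict a _ (worldsOfForm_subset_or_left hCn a b) (h.or_meets_left hCn hab)
    (h.high_mono b _ (worldsOfForm_subset_or_right hCn a b) hb)

theorem subset_union (h : IsTwoLevelChoice Cn K rev F H) (hCn : IsConsequence Cn)
    (a b : Form Atom) : F (Form.or a b) ⊆ F a ∪ F b := by
  intro M hM
  have := h.subset _ hM
  rw [worldsOfForm_or hCn] at this
  refine this.imp (fun h' => ?_) fun h' => ?_
  · rw [h.restrict a _ (worldsOfForm_subset_or_left hCn a b) ⟨M, hM, h'⟩]; exact ⟨hM, h'⟩
  · rw [h.restrict b _ (worldsOfForm_subset_or_right hCn a b) ⟨M, hM, h'⟩]; exact ⟨hM, h'⟩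

end IsTwoLevelChoice

/-! ### Postulates and choice functions -/

/-- The list of postulates of a two level credibility-limited revision. -/
def SatisfiesPostulates (Cn : Set (Form Atom) → Set (Form Atom)) (K : Set (Form Atom))
    (rev : Form Atom → Set (Form Atom)) : Prop :=
  WeakRelativeSuccess K rev ∧ Closure Cn rev ∧ Inclusion Cn K rev ∧
    ConsistencyPreservation Cn K rev ∧ Vacuity Cn K rev ∧ Extensionality Cn rev ∧
    StrictImprovement Cn rev ∧ NPersistence rev ∧ NRecovery Cn K rev ∧
    DisjunctiveOverlap rev ∧ DisjunctiveInclusion rev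

variable {K : Set (Form Atom)} {rev : Form Atom → Set (Form Atom)}

theorem IsTwoLevelChoice.rev_eq_inter (hCn : IsConsequence Cn) (hK : K = Cn K)
    {F : Form Atom → Set (World Cn)} {H : Set (Form Atom)} (h : IsTwoLevelChoice Cn K rev F H)
    {a : Form Atom} (ha : a ∉ H) : rev a = K ∩ theoryOf (F a) := by
  rw [h.rev_low a ha, theoryOf_union, theoryOf_worldsOf hCn hK]

theorem IsTwoLevelChoice.satisfiesPostulates (hCn : IsConsequence Cn) (hK : K = Cn K)
    (hKc : Consistent Cn K) {F : Form Atom → Set (World Cn)} {H : Set (Form Atom)}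
    (h : IsTwoLevelChoice Cn K rev F H) : SatisfiesPostulates Cn K rev := by
  have hne : (worldsOf Cn K).Nonempty := (consistent_iff_nonempty hCn).1 hKc
  have hsucc : ∀ a ∈ H, a ∈ rev a := fun a ha => by
    rw [h.rev_high a ha]
    exact fun M hM => (mem_worldsOfForm hCn).1 (h.subset a hM)
  have hsub : ∀ a, a ∉ H → rev a ⊆ K := fun a ha =>
    h.rev_eq_inter hCn hK ha ▸ Set.inter_subset_left
  have hF : ∀ a, rev a ⊆ theoryOf (F a) := fun a => by
    by_cases ha : a ∈ H
    · rw [h.rev_high a ha]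
    · exact h.rev_eq_inter hCn hK ha ▸ Set.inter_subset_right
  have hhigh : ∀ a, a ∈ rev a → a ∈ H := fun a ha => by
    by_contra hn
    obtain ⟨M, hM⟩ := hne
    exact hn (h.centre_high a ⟨M, hM, (mem_worldsOfForm hCn).2 (hM (hsub a hn ha))⟩)
  refine ⟨?_, ?_, ?_, ?_, ?_, ?_, ?_, ?_, ?_, ?_, ?_⟩
  · intro a
    by_cases ha : a ∈ H
    · exact Or.inl (hsucc a ha)
    · exact Or.inr (hsub a ha)
  · intro a
    by_cases ha : a ∈ H
    · rw [h.rev_high a ha]; exact theoryOf_closed hCn _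
    · rw [h.rev_low a ha]; exact theoryOf_closed hCn _
  · intro a x hx
    rw [mem_expand_iff hCn]
    intro M hM haM
    have hMa : M ∈ worldsOf Cn K ∩ worldsOfForm Cn a := ⟨hM, (mem_worldsOfForm hCn).2 haM⟩
    refine hF a hx M ?_
    rwa [h.centre a ⟨M, hMa⟩]
  · intro _ a
    by_cases ha : a ∈ H
    · rw [h.rev_high a ha]; exact theoryOf_consistent hCn (h.high_nonempty a ha)
    · rw [h.rev_low a ha]; exact theoryOf_consistent hCn (hne.mono Set.subset_union_left)
  · intro a ha x hx
    have hm := (neg_notMem_iff hCn hK).1 ha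
    rw [h.rev_high a (h.centre_high a hm), h.centre a hm]
    exact fun M hM => (mem_expand_iff hCn).1 hx M hM.1 ((mem_worldsOfForm hCn).1 hM.2)
  · intro a b hab
    rw [thm_iff_iff hCn] at hab
    by_cases ha : a ∈ H
    · rw [h.rev_high a ha, h.rev_high b ((h.high_congr hab).1 ha), h.congr hab]
    · rw [h.rev_low a ha, h.rev_low b (fun hb => ha ((h.high_congr hab).2 hb)), h.congr hab]
  · intro a b ha hab
    exact hsucc b (h.high_mono a b ((thm_imp_iff hCn).1 hab) (hhigh a ha))
  · intro a b hb
    have hFb : ¬ (F b).Nonempty := fun ⟨M, hM⟩ =>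
      (M.neg_mem_iff hCn).1 (hF b hb M hM) ((mem_worldsOfForm hCn).1 (h.subset b hM))
    have hFa : Form.neg b ∈ theoryOf (F a) := by
      by_contra hn
      exact hFb (h.nonempty_of_meets hCn ((neg_notMem_theoryOf_iff hCn).1 hn))
    by_cases ha : a ∈ H
    · rwa [h.rev_high a ha]
    · rw [h.rev_eq_inter hCn hK ha]
      exact ⟨hsub b (fun hb => hFb (h.high_nonempty b hb)) hb, hFa⟩
  · intro a x hx
    rw [mem_expand_iff hCn]
    intro M hM hMa
    have hor : Form.or a x ∈ rev a := by
      have hFa : Form.or a x ∈ theoryOf (F a) := fun N hN =>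
        (N.or_mem_iff hCn).2 (Or.inl ((mem_worldsOfForm hCn).1 (h.subset a hN)))
      by_cases ha : a ∈ H
      · rwa [h.rev_high a ha]
      · rw [h.rev_low a ha]
        rintro N (hN | hN)
        · exact (N.or_mem_iff hCn).2 (Or.inr (hN hx))
        · exact hFa N hN
    exact ((M.or_mem_iff hCn).1 (hM hor)).resolve_left ((M.neg_mem_iff hCn).1 hMa)
  · rintro a b x ⟨hxa, hxb⟩
    have hx : x ∈ theoryOf (F (Form.or a b)) := fun M hM =>
      (h.subset_union hCn a b hM).elim (hF a hxa M) (hF b hxb M)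
    by_cases hab : Form.or a b ∈ H
    · rwa [h.rev_high _ hab]
    · rw [h.rev_eq_inter hCn hK hab]
      exact ⟨hsub a
        (fun ha => hab (h.high_mono a _ (worldsOfForm_subset_or_left hCn a b) ha)) hxa, hx⟩
  · intro a b hn
    have hsubor := worldsOfForm_subset_or_left hCn a b
    by_cases hab : Form.or a b ∈ H
    · rw [h.rev_high _ hab] at hn ⊢
      have hm := (neg_notMem_theoryOf_iff hCn).1 hn
      rw [h.rev_high a (h.high_restrict a _ hsubor hm hab), h.restrict a _ hsubor hm]
      exact fun x hx M hM => hx M hM.1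
    · have ha : a ∉ H := fun ha => hab (h.high_mono a _ hsubor ha)
      rw [h.rev_low _ hab] at hn ⊢
      rw [h.rev_low a ha]
      obtain ⟨M, hM | hM, hMa⟩ := (neg_notMem_theoryOf_iff hCn).1 hn
      · exact absurd (h.centre_high a ⟨M, hM, hMa⟩) ha
      · rw [h.restrict a _ hsubor ⟨M, hM, hMa⟩]
        exact fun x hx N hN => hx N (hN.imp id And.left)

theorem SatisfiesPostulates.isTwoLevelChoice (hCn : IsConsequence Cn) (hK : K = Cn K)
    (hKc : Consistent Cn K) (h : SatisfiesPostulates Cn K rev) :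
    IsTwoLevelChoice Cn K rev (fun a => worldsOf Cn (rev a) ∩ worldsOfForm Cn a)
      {a | a ∈ rev a} := by
  obtain ⟨hwrs, hclo, hinc, hcons, hvac, hext, himp, hper, hrec, hover, hdinc⟩ := h
  have hmem : ∀ {a x}, (∀ M : World Cn, rev a ⊆ M.1 → x ∈ M.1) → x ∈ rev a := fun {a x} hx => by
    rw [hclo a]; exact (mem_Cn_iff hCn).2 hx
  have hneg : ∀ {a b}, Form.neg a ∉ rev b ↔ (worldsOf Cn (rev b) ∩ worldsOfForm Cn a).Nonempty :=
    fun {a b} => neg_notMem_iff hCn (hclo b)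
  have hor : ∀ {a b}, worldsOfForm Cn a ⊆ worldsOfForm Cn b → rev b = rev (Form.or a b) :=
    fun {a b} hab => hext _ _ <| (thm_iff_iff hCn).2 <| by
      rw [worldsOfForm_or hCn, Set.union_eq_right.2 hab]
  have hmeet : ∀ {a b}, worldsOfForm Cn a ⊆ worldsOfForm Cn b →
      (worldsOf Cn (rev b) ∩ worldsOfForm Cn b ∩ worldsOfForm Cn a).Nonempty →
      Form.neg a ∉ rev b := fun {a b} hab ⟨M, hM⟩ => hneg.2 ⟨M, hM.1.1, hM.2⟩
  have hcen : ∀ {a}, Form.neg a ∉ K → rev a = expand Cn K a := fun {a} ha =>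
    (hinc a).antisymm (hvac a ha)
  have hexp_self : ∀ {A a}, a ∈ expand Cn A a := fun {A a} =>
    (mem_expand_iff hCn).2 fun M _ ha => ha
  -- A form of AGM's superexpansion: what holds after revising by `a` holds at the
  -- `a`-worlds of the outcome of revising by any weaker `b`.
  have hsuper : ∀ {a b x}, worldsOfForm Cn a ⊆ worldsOfForm Cn b → x ∈ rev a →
      Form.imp a x ∈ rev b := by
    intro a b x hab hx
    obtain ⟨c, hc, hac⟩ := exists_diff hCn hab
    have hbc : rev (Form.or a c) = rev b := hext _ _ ((thm_iff_iff hCn).2 hac)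
    by_cases ha : Form.neg a ∈ K
    · rw [← hbc]
      refine hover a c ⟨hmem fun M hM => (M.imp_mem_iff hCn).2 fun _ => hM hx, hmem fun M hM => ?_⟩
      rw [M.imp_mem_iff hCn]
      intro haM
      -- A `c`-world is no `a`-world, and by recovery `¬a ∈ K` holds in the worlds of
      -- `rev c` outside `‖c‖`.
      have hcn : c ∉ M.1 := fun h => hc M h haM
      exact absurd haM ((M.neg_mem_iff hCn).1
        ((mem_expand_iff hCn).1 (hrec c ha) M hM ((M.neg_mem_iff hCn).2 hcn)))
    · have hb : Form.neg b ∉ K := by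
        rw [neg_notMem_iff hCn hK] at ha ⊢
        exact ha.mono fun M hM => ⟨hM.1, hab hM.2⟩
      rw [hcen hb, mem_expand_iff hCn]
      rw [hcen ha, mem_expand_iff hCn] at hx
      exact fun M hM _ => (M.imp_mem_iff hCn).2 (hx M hM)
  refine ⟨?_, ?_, ?_, ?_, ?_, ?_, ?_, ?_, ?_, ?_⟩
  · exact fun a => Set.inter_subset_right
  · intro a b hab ha
    rw [← hneg] at ha ⊢
    refine fun hb => ha (hmem fun M hM => ?_)
    have := hM (hper a b hb)
    rw [M.neg_mem_iff hCn, ← mem_worldsOfForm hCn] at this ⊢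
    exact fun h => this (hab h)
  · intro a b hab hm
    have hsub : rev b ⊆ rev a := by
      have := hmeet hab hm
      rw [hor hab] at this ⊢
      exact hdinc a b this
    refine Set.Subset.antisymm (fun M hM => ⟨⟨hsub.trans hM.1, hab hM.2⟩, hM.2⟩) ?_
    rintro M ⟨⟨hM, _⟩, hMa⟩
    exact ⟨fun x hx => (M.imp_mem_iff hCn).1 (hM (hsuper hab hx)) ((mem_worldsOfForm hCn).1 hMa),
      hMa⟩
  · intro a ha
    obtain ⟨M, hM⟩ := (hcons hKc a).exists_world hCn
    exact ⟨M, hM, (mem_worldsOfForm hCn).2 (hM ha)⟩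
  · exact fun a b hab ha => himp a b ha ((thm_imp_iff hCn).2 hab)
  · intro a b hab hm hb
    by_cases haK : Form.neg a ∈ K
    · by_contra ha
      have hn := hmeet hab hm
      have hbK : b ∈ K := by
        refine (hwrs a).resolve_left ha ?_
        have hb' : b ∈ rev b := hb
        rw [hor hab] at hn hb'
        exact hdinc a b hn hb'
      -- As `b ∈ K`, revising by `b` returns `K`, which contains `¬a`.
      have hbn : Form.neg b ∉ K := by
        rw [neg_notMem_iff hCn hK]
        obtain ⟨M, hM⟩ := hKc.exists_world hCn
        exact ⟨M, hM, (mem_worldsOfForm hCn).2 (hM hbK)⟩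
      rw [hcen hbn] at hn
      exact hn ((mem_expand_iff hCn).2 fun M hM _ => hM haK)
    · exact (hcen haK).superset hexp_self
  · intro a ha
    rw [hcen ((neg_notMem_iff hCn hK).2 ha)]
    ext M
    refine ⟨fun h => ⟨fun x hx => h.1 ((mem_expand_iff hCn).2 fun N hN _ => hN hx), h.2⟩,
      fun h => ⟨fun x hx => (mem_expand_iff hCn).1 hx M h.1 ((mem_worldsOfForm hCn).1 h.2), h.2⟩⟩
  · intro a ha
    exact (hcen ((neg_notMem_iff hCn hK).2 ha)).superset hexp_self
  · intro a ha
    have : worldsOf Cn (rev a) ∩ worldsOfForm Cn a = worldsOf Cn (rev a) :=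
      Set.inter_eq_left.2 fun M hM => (mem_worldsOfForm hCn).2 (hM ha)
    rw [this, theoryOf_worldsOf hCn (hclo a)]
  · intro a ha
    have haK := (hwrs a).resolve_left ha
    rw [theoryOf_union, theoryOf_worldsOf hCn hK]
    refine Set.Subset.antisymm (fun x hx => ⟨haK hx, fun M hM => hM.1 hx⟩) ?_
    rintro x ⟨hxK, hx⟩
    refine hmem fun M hM => ?_
    by_cases haM : a ∈ M.1
    · exact hx M ⟨hM, (mem_worldsOfForm hCn).2 haM⟩
    · exact (mem_expand_iff hCn).1 (hrec a hxK) M hM ((M.neg_mem_iff hCn).2 haM)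

/-! ### Sphere systems and choice functions -/

theorem isTwoLevelChoice_of_spheres (hCn : IsConsequence Cn) (hK : K = Cn K)
    {Si S : Set (Set (World Cn))}
    (hS : IsTwoLevelSphereSystem Cn K Si S) (h : IsInducedBySpheres Cn K Si S rev) :
    IsTwoLevelChoice Cn K rev
      (fun a => {M | ∃ X, IsSmallestSphere Cn S a X ∧ M ∈ X ∧ M ∈ worldsOfForm Cn a})
      {a | ∃ X, IsSmallestSphere Cn S a X ∧ X ∈ Si} := by
  have huniq : ∀ {a X Y}, IsSmallestSphere Cn S a X → IsSmallestSphere Cn S a Y → X = Y :=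
    fun hX hY => IsLeast.unique hX hY
  have hF : ∀ {a X}, IsSmallestSphere Cn S a X →
      {M | ∃ X, IsSmallestSphere Cn S a X ∧ M ∈ X ∧ M ∈ worldsOfForm Cn a} =
        X ∩ worldsOfForm Cn a := fun {a X} hX => by
    ext M
    refine ⟨fun ⟨Y, hY, hM⟩ => ?_, fun hM => ⟨X, hX, hM⟩⟩
    rwa [huniq hX hY]
  have hrestr : ∀ {a b X}, worldsOfForm Cn a ⊆ worldsOfForm Cn b → IsSmallestSphere Cn S b X →
      (X ∩ worldsOfForm Cn a).Nonempty → IsSmallestSphere Cn S a X :=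
    fun {a b X} hab hX hm => ⟨⟨hX.1.1, hm⟩, fun Y hY =>
      hX.2 ⟨hY.1, hY.2.mono (Set.inter_subset_inter_right _ hab)⟩⟩
  have hcen : ∀ {a}, (worldsOf Cn K ∩ worldsOfForm Cn a).Nonempty →
      IsSmallestSphere Cn S a (worldsOf Cn K) := fun {a} ha =>
    ⟨⟨hS.outer.centre_mem, ha⟩, fun Y hY => hS.outer.centre_subset Y hY.1⟩
  have hmono : ∀ {a b X}, worldsOfForm Cn a ⊆ worldsOfForm Cn b → IsSmallestSphere Cn S a X →
      ∃ Y, IsSmallestSphere Cn S b Y ∧ Y ⊆ X := fun {a b X} hab hX => by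
    have hb : (X ∩ worldsOfForm Cn b).Nonempty :=
      hX.1.2.mono (Set.inter_subset_inter_right _ hab)
    obtain ⟨Y, hY⟩ := hS.outer.smallest b ⟨X, hX.1.1, hb⟩
    exact ⟨Y, hY, hY.2 ⟨hX.1.1, hb⟩⟩
  refine ⟨?_, ?_, ?_, ?_, ?_, ?_, ?_, ?_, ?_, ?_⟩
  · exact fun a M ⟨X, _, _, hM⟩ => hM
  · rintro a b hab ⟨M, X, hX, hM⟩
    obtain ⟨Y, hY, -⟩ := hmono hab hX
    rw [hF hY]
    exact hY.1.2
  · rintro a b hab ⟨M, ⟨X, hX, hM⟩, hMa⟩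
    rw [hF hX, hF (hrestr hab hX ⟨M, hM.1, hMa⟩), Set.inter_assoc, Set.inter_eq_right.2 hab]
  · rintro a ⟨X, hX, -⟩
    rw [hF hX]
    exact hX.1.2
  · rintro a b hab ⟨X, hX, hXi⟩
    obtain ⟨Y, hY, hYX⟩ := hmono hab hX
    refine ⟨Y, hY, ?_⟩
    by_contra hn
    exact hn (hYX.antisymm (hS.innermost X hXi Y ⟨hY.1.1, hn⟩) ▸ hXi)
  · rintro a b hab ⟨M, ⟨X, hX, hM⟩, hMa⟩ ⟨Y, hY, hYi⟩
    exact ⟨X, hrestr hab hX ⟨M, hM.1, hMa⟩, huniq hX hY ▸ hYi⟩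
  · exact fun a ha => hF (hcen ha)
  · exact fun a ha => ⟨_, hcen ha, hS.inner.centre_mem⟩
  · rintro a ⟨X, hX, hXi⟩
    rw [hF hX]
    exact h.high a X hX hXi
  · intro a ha
    by_cases hex : ∃ U ∈ S, (U ∩ worldsOfForm Cn a).Nonempty
    · obtain ⟨X, hX⟩ := hS.outer.smallest a hex
      rw [hF hX]
      exact h.low a X hX ⟨hX.1.1, fun hXi => ha ⟨X, hX, hXi⟩⟩
    · have hempty : {M | ∃ X, IsSmallestSphere Cn S a X ∧ M ∈ X ∧ M ∈ worldsOfForm Cn a} = ∅ :=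
        Set.eq_empty_of_forall_notMem fun M ⟨X, hX, hM⟩ => hex ⟨X, hX.1.1, M, hM⟩
      rw [hempty, Set.union_empty, theoryOf_worldsOf hCn hK]
      refine h.none a fun X hX => ?_
      by_contra hne
      exact hex ⟨X, hX, Set.nonempty_iff_ne_empty.2 hne⟩

/-- Grove's sphere of a sentence `a`: the best worlds of all sentences weaker than `a`. -/
def sphere (F : Form Atom → Set (World Cn)) (a : Form Atom) : Set (World Cn) :=
  {M | ∃ b, worldsOfForm Cn a ⊆ worldsOfForm Cn b ∧ M ∈ F b}

namespace IsTwoLevelChoice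

variable {F : Form Atom → Set (World Cn)} {H : Set (Form Atom)}

theorem sphere_inter (h : IsTwoLevelChoice Cn K rev F H) (a : Form Atom) :
    sphere F a ∩ worldsOfForm Cn a = F a := by
  ext M
  constructor
  · rintro ⟨⟨b, hab, hM⟩, hMa⟩
    rw [h.restrict a b hab ⟨M, hM, hMa⟩]
    exact ⟨hM, hMa⟩
  · exact fun hM => ⟨⟨a, subset_rfl, hM⟩, h.subset a hM⟩

/-- A more plausible sentence has a smaller sphere. -/
theorem sphere_subset_sphere (h : IsTwoLevelChoice Cn K rev F H) (hCn : IsConsequence Cn)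
    {a b : Form Atom} (hab : (F (Form.or a b) ∩ worldsOfForm Cn a).Nonempty) :
    sphere F a ⊆ sphere F b := by
  rintro M ⟨c, hac, hM⟩
  have hsub : worldsOfForm Cn (Form.or a b) ⊆ worldsOfForm Cn (Form.or c b) := by
    rw [worldsOfForm_or hCn, worldsOfForm_or hCn]
    exact Set.union_subset_union_left _ hac
  have hc : (F (Form.or c b) ∩ worldsOfForm Cn c).Nonempty := by
    rcases h.meets_or hCn c b (h.nonempty_mono _ _ hsub hab.left) with hc | ⟨N, hN, hNb⟩
    · exact hc
    · rw [h.restrict _ _ hsub ⟨N, hN, worldsOfForm_subset_or_right hCn a b hNb⟩] at hab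
      exact hab.mono fun N hN => ⟨hN.1.1, hac hN.2⟩
  rw [h.restrict c _ (worldsOfForm_subset_or_left hCn c b) hc] at hM
  exact ⟨_, worldsOfForm_subset_or_right hCn c b, hM.1⟩

theorem sphere_subset_of_meets (h : IsTwoLevelChoice Cn K rev F H) (hCn : IsConsequence Cn)
    {a b : Form Atom} (hab : (sphere F b ∩ worldsOfForm Cn a).Nonempty) :
    sphere F a ⊆ sphere F b := by
  obtain ⟨M, ⟨c, hbc, hM⟩, hMa⟩ := hab
  have hsub : worldsOfForm Cn (Form.or a b) ⊆ worldsOfForm Cn (Form.or a c) := by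
    rw [worldsOfForm_or hCn, worldsOfForm_or hCn]
    exact Set.union_subset_union_right _ hbc
  obtain ⟨N, hN, hNa⟩ := h.or_meets_left hCn ⟨M, hM, hMa⟩
  have hNab := worldsOfForm_subset_or_left hCn a b hNa
  refine h.sphere_subset_sphere hCn ⟨N, ?_, hNa⟩
  rw [h.restrict _ _ hsub ⟨N, hN, hNab⟩]
  exact ⟨hN, hNab⟩

theorem exists_spheres (h : IsTwoLevelChoice Cn K rev F H) (hCn : IsConsequence Cn)
    (hK : K = Cn K) (hKc : Consistent Cn K) : IsSphereBasedTwoLevelCLRevision Cn K rev := by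
  rcases isEmpty_or_nonempty (Form Atom) with hemp | ⟨⟨p⟩⟩
  -- Without sentences there is no tautology to index the central sphere.
  · have hsys : IsSphereSystem Cn K {worldsOf Cn K} :=
      ⟨by rintro _ rfl _ rfl; exact Or.inl subset_rfl, rfl, by rintro _ rfl; exact subset_rfl,
        fun a => hemp.elim a⟩
    exact ⟨{worldsOf Cn K}, {worldsOf Cn K}, ⟨hsys, hsys, subset_rfl, fun X _ Y hY =>
      absurd hY.1 hY.2⟩, ⟨fun a => hemp.elim a, fun a => hemp.elim a, fun a => hemp.elim a⟩⟩
  set t := Form.imp p p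
  have ht : ∀ M : World Cn, M ∈ worldsOfForm Cn t := fun M =>
    (mem_worldsOfForm hCn).2 ((M.imp_mem_iff hCn).2 id)
  have hKt : ∀ {b}, worldsOfForm Cn t ⊆ worldsOfForm Cn b → F b = worldsOf Cn K := fun {b} hb => by
    have : worldsOf Cn K ∩ worldsOfForm Cn b = worldsOf Cn K :=
      Set.inter_eq_left.2 fun M _ => hb (ht M)
    rw [h.centre b (this.symm ▸ hKc.exists_world hCn), this]
  have hst : sphere F t = worldsOf Cn K := by
    ext M
    exact ⟨fun ⟨b, hb, hM⟩ => hKt hb ▸ hM, fun hM => ⟨t, subset_rfl, hKt subset_rfl ▸ hM⟩⟩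
  have htH : t ∈ H := by
    obtain ⟨M, hM⟩ := hKc.exists_world hCn
    exact h.centre_high t ⟨M, hM, ht M⟩
  have hcen : ∀ a, worldsOf Cn K ⊆ sphere F a := fun a M hM =>
    ⟨t, fun N _ => ht N, hKt subset_rfl ▸ hM⟩
  have htot : ∀ {a b}, (F a).Nonempty → sphere F a ⊆ sphere F b ∨ sphere F b ⊆ sphere F a := by
    intro a b ha
    have hne := h.nonempty_mono a _ (worldsOfForm_subset_or_left hCn a b) ha
    refine (h.meets_or hCn a b hne).imp (h.sphere_subset_sphere hCn) fun hm => ?_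
    refine h.sphere_subset_sphere hCn ?_
    rwa [h.congr (b := Form.or a b) (by rw [worldsOfForm_or hCn, worldsOfForm_or hCn,
      Set.union_comm])]
  have hcred : ∀ {a b}, (sphere F b ∩ worldsOfForm Cn a).Nonempty → (F a).Nonempty :=
    fun ⟨M, ⟨c, _, hM⟩, hMa⟩ => h.nonempty_of_meets hCn ⟨M, hM, hMa⟩
  have hcredH : ∀ {a b}, b ∈ H → (sphere F b ∩ worldsOfForm Cn a).Nonempty → a ∈ H :=
    fun hb ⟨M, ⟨c, hbc, hM⟩, hMa⟩ =>
      h.high_of_meets hCn (h.high_mono _ c hbc hb) ⟨M, hM, hMa⟩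
  set S : Set (Set (World Cn)) := sphere F '' {a | (F a).Nonempty}
  set Si : Set (Set (World Cn)) := sphere F '' H
  have hSi : Si ⊆ S := Set.image_mono fun a ha => h.high_nonempty a ha
  have hmeet : ∀ {a}, (F a).Nonempty → (sphere F a ∩ worldsOfForm Cn a).Nonempty := fun {a} ha => by
    rwa [h.sphere_inter a]
  have hleast : ∀ {a}, (F a).Nonempty → IsSmallestSphere Cn S a (sphere F a) := by
    intro a ha
    refine ⟨⟨⟨a, ha, rfl⟩, hmeet ha⟩, ?_⟩
    rintro _ ⟨⟨b, _, rfl⟩, hm⟩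
    exact h.sphere_subset_of_meets hCn hm
  have hmemSi : ∀ {a}, (F a).Nonempty → sphere F a ∈ Si → a ∈ H := by
    rintro a ha ⟨b, hb, hba⟩
    exact hcredH hb (hba ▸ hmeet ha)
  have hSof : ∀ {a X}, IsSmallestSphere Cn S a X → (F a).Nonempty ∧ X = sphere F a := by
    rintro a X hX
    obtain ⟨b, _, rfl⟩ := hX.1.1
    have ha := hcred hX.1.2
    exact ⟨ha, IsLeast.unique hX (hleast ha)⟩
  refine ⟨Si, S, ⟨⟨?_, ⟨t, htH, hst⟩, ?_, ?_⟩, ⟨?_, hSi ⟨t, htH, hst⟩, ?_, ?_⟩, hSi, ?_⟩,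
    ?_, ?_, ?_⟩
  · rintro _ ⟨a, ha, rfl⟩ _ ⟨b, _, rfl⟩
    exact htot (h.high_nonempty a ha)
  · rintro _ ⟨a, ha, rfl⟩
    exact hcen a
  · rintro a ⟨_, ⟨b, hb, rfl⟩, hm⟩
    have ha := hcredH hb hm
    have hl := hleast (h.high_nonempty a ha)
    exact ⟨sphere F a, ⟨⟨a, ha, rfl⟩, hl.1.2⟩, fun Y hY => hl.2 ⟨hSi hY.1, hY.2⟩⟩
  · rintro _ ⟨a, ha, rfl⟩ _ ⟨b, _, rfl⟩
    exact htot ha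
  · rintro _ ⟨a, ha, rfl⟩
    exact hcen a
  · rintro a ⟨_, ⟨b, hb, rfl⟩, hm⟩
    exact ⟨sphere F a, hleast (hcred hm)⟩
  · rintro _ ⟨a, ha, rfl⟩ _ ⟨⟨b, hb, rfl⟩, hbS⟩
    have hor := h.high_mono a _ (worldsOfForm_subset_or_left hCn a b) ha
    rcases h.meets_or hCn a b (h.high_nonempty _ hor) with hm | hm
    · exact h.sphere_subset_sphere hCn hm
    · exact absurd ⟨b, h.high_of_meets hCn hor hm, rfl⟩ hbS
  · intro a X hX hXi
    obtain ⟨ha, rfl⟩ := hSof hX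
    rw [h.sphere_inter a]
    exact h.rev_high a (hmemSi ha hXi)
  · rintro a X hX ⟨-, hXi⟩
    obtain ⟨ha, rfl⟩ := hSof hX
    rw [h.sphere_inter a]
    exact h.rev_low a fun haH => hXi ⟨a, haH, rfl⟩
  · intro a ha
    have hFa : F a = ∅ := by
      by_contra hne
      have hne := Set.nonempty_iff_ne_empty.2 hne
      exact (hmeet hne).ne_empty (ha _ ⟨a, hne, rfl⟩)
    rw [h.rev_low a fun haH => (h.high_nonempty a haH).ne_empty hFa, hFa, Set.union_empty,
      theoryOf_worldsOf hCn hK]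

end IsTwoLevelChoice

/-! ### AGM revision and choice functions -/

/-- `rev` is induced by an AGM revision and by sets `CH`, `CL` of credible sentences that meet the
conditions of a two level credibility-limited revision. -/
def IsInducedByAGM (Cn : Set (Form Atom) → Set (Form Atom)) (K : Set (Form Atom))
    (rev : Form Atom → Set (Form Atom)) : Prop :=
  ∃ (star : Form Atom → Set (Form Atom)) (CH CL : Set (Form Atom)),
    IsAGMRevision Cn K star ∧ IsTwoLevelCLRevision Cn K star CH CL rev ∧
    CredibilityOfLogicalEquivalents Cn CL ∧ ElementConsistency Cn CL ∧ CH ∩ CL = ∅ ∧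
    ElementConsistency Cn CH ∧ CredibilityLowerBounding Cn K CH ∧ SingleSentenceClosure Cn CH ∧
    CredStar (CH ∪ CL) star ∧ CredStar CH star

open Classical in
/-- The best worlds for a total revision: those chosen by `F`, and all `a`-worlds if `a` is not
credible. In terms of spheres, the set of all worlds is added as an outermost sphere. -/
noncomputable def totalChoice (F : Form Atom → Set (World Cn)) (a : Form Atom) :
    Set (World Cn) :=
  if (F a).Nonempty then F a else worldsOfForm Cn a

theorem IsTwoLevelChoice.isAGMRevision (hCn : IsConsequence Cn) (hK : K = Cn K)
    {F : Form Atom → Set (World Cn)} {H : Set (Form Atom)} (h : IsTwoLevelChoice Cn K rev F H) :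
    IsAGMRevision Cn K fun a => theoryOf (totalChoice F a) := by
  have hpos : ∀ {a}, (F a).Nonempty → totalChoice F a = F a := fun ha => if_pos ha
  have hneg : ∀ {a}, ¬ (F a).Nonempty → totalChoice F a = worldsOfForm Cn a := fun ha => if_neg ha
  have hsub : ∀ a, totalChoice F a ⊆ worldsOfForm Cn a := fun a => by
    by_cases ha : (F a).Nonempty
    · rw [hpos ha]; exact h.subset a
    · rw [hneg ha]
  have hcen : ∀ {a}, (worldsOf Cn K ∩ worldsOfForm Cn a).Nonempty →
      totalChoice F a = worldsOf Cn K ∩ worldsOfForm Cn a := fun {a} ha => by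
    have := h.centre a ha
    rw [hpos (this.symm ▸ ha), this]
  refine ⟨⟨fun a => theoryOf_closed hCn _, ?_, ?_, ?_, ?_, ?_⟩, ?_, ?_⟩
  · exact fun a M hM => (mem_worldsOfForm hCn).1 (hsub a hM)
  · intro a x hx
    rw [mem_expand_iff hCn]
    intro M hM haM
    have hMa : M ∈ worldsOf Cn K ∩ worldsOfForm Cn a := ⟨hM, (mem_worldsOfForm hCn).2 haM⟩
    exact hx M (hcen ⟨M, hMa⟩ ▸ hMa)
  · intro a ha x hx M hM
    rw [hcen ((neg_notMem_iff hCn hK).1 ha)] at hM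
    exact (mem_expand_iff hCn).1 hx M hM.1 ((mem_worldsOfForm hCn).1 hM.2)
  · intro a ha
    refine theoryOf_consistent hCn ?_
    by_cases hF : (F a).Nonempty
    · rwa [hpos hF]
    · rw [hneg hF]; exact (consistent_singleton_iff hCn).1 ha
  · intro a b hab
    rw [thm_iff_iff hCn] at hab
    dsimp only
    by_cases ha : (F a).Nonempty
    · rw [hpos ha, hpos (h.congr hab ▸ ha), h.congr hab]
    · rw [hneg ha, hneg (h.congr hab ▸ ha), hab]
  · rintro a b x ⟨hxa, hxb⟩ M hM
    by_cases hab : (F (Form.or a b)).Nonempty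
    · rw [hpos hab] at hM
      rcases h.subset_union hCn a b hM with hM | hM
      · exact hxa M (hpos ⟨M, hM⟩ ▸ hM)
      · exact hxb M (hpos ⟨M, hM⟩ ▸ hM)
    · rw [hneg hab, worldsOfForm_or hCn] at hM
      rcases hM with hM | hM
      · have hF : ¬ (F a).Nonempty := fun hF =>
          hab (h.nonempty_mono a _ (worldsOfForm_subset_or_left hCn a b) hF)
        exact hxa M (hneg hF ▸ hM)
      · have hF : ¬ (F b).Nonempty := fun hF =>
          hab (h.nonempty_mono b _ (worldsOfForm_subset_or_right hCn a b) hF)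
        exact hxb M (hneg hF ▸ hM)
  · intro a b hn x hx M hM
    have hm := (neg_notMem_theoryOf_iff hCn).1 hn
    refine hx M ?_
    by_cases hab : (F (Form.or a b)).Nonempty
    · rw [hpos hab] at hm ⊢
      have hr := h.restrict a _ (worldsOfForm_subset_or_left hCn a b) hm
      rw [hpos (hr ▸ hm), hr] at hM
      exact hM.1
    · rw [hneg hab]
      exact worldsOfForm_subset_or_left hCn a b (hsub a hM)

theorem IsTwoLevelChoice.isInducedByAGM (hCn : IsConsequence Cn) (hK : K = Cn K)
    (hKc : Consistent Cn K) {F : Form Atom → Set (World Cn)} {H : Set (Form Atom)}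
    (h : IsTwoLevelChoice Cn K rev F H) : IsInducedByAGM Cn K rev := by
  have hpos : ∀ {a}, (F a).Nonempty → totalChoice F a = F a := fun ha => if_pos ha
  have hcons : ∀ {a}, (F a).Nonempty → Consistent Cn {a} := fun {a} ha =>
    (consistent_singleton_iff hCn).2 (ha.mono (h.subset a))
  have hagm := h.isAGMRevision hCn hK
  refine ⟨_, H, {a | (F a).Nonempty ∧ a ∉ H}, hagm, ⟨hagm.toIsBasicAGMRevision, ?_, ?_, ?_⟩,
    ?_, ?_, ?_, ?_, ?_, ?_, ?_, ?_⟩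
  · intro a ha
    rw [hpos (h.high_nonempty a ha), h.rev_high a ha]
  · rintro a ⟨ha, haH⟩
    rw [hpos ha, h.rev_eq_inter hCn hK haH, Set.inter_comm]
  · intro a ha
    have haH : a ∉ H := fun h => ha (Or.inr h)
    have hFa : F a = ∅ := Set.not_nonempty_iff_eq_empty.1 fun h => ha (Or.inl ⟨h, haH⟩)
    rw [h.rev_low a haH, hFa, Set.union_empty, theoryOf_worldsOf hCn hK]
  · intro a b hab
    rw [thm_iff_iff hCn] at hab
    rw [Set.mem_ofPred_eq, Set.mem_ofPred_eq, h.congr hab, h.high_congr hab]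
  · exact fun a ha => hcons ha.1
  · exact Set.eq_empty_of_forall_notMem fun a ha => ha.2.2 ha.1
  · exact fun a ha => hcons (h.high_nonempty a ha)
  · intro _ a ha
    obtain ⟨M, hM⟩ := hKc.exists_world hCn
    exact h.centre_high a ⟨M, hM, (mem_worldsOfForm hCn).2 (hM ha)⟩
  · exact fun a ha b hb => h.high_mono a b ((mem_Cn_singleton_iff hCn).1 hb) ha
  · intro a b ha hb
    by_contra hn
    have hFb : (F b).Nonempty := hb.elim (h.high_nonempty b) And.left
    have hm := (neg_notMem_theoryOf_iff hCn).1 hn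
    rw [hpos hFb] at hm
    by_cases haH : a ∈ H
    · exact ha (Or.inl haH)
    · exact ha (Or.inr ⟨h.nonempty_of_meets hCn hm, haH⟩)
  · intro a b ha hb
    by_contra hn
    have hm := (neg_notMem_theoryOf_iff hCn).1 hn
    rw [hpos (h.high_nonempty b hb)] at hm
    exact ha (h.high_of_meets hCn hb hm)

theorem IsInducedByAGM.exists_isTwoLevelChoice (hCn : IsConsequence Cn) (hK : K = Cn K)
    (hKc : Consistent Cn K) (h : IsInducedByAGM Cn K rev) :
    ∃ F H, IsTwoLevelChoice Cn K rev F H := by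
  obtain ⟨star, CH, CL, hs, hrev, _, hCLc, _, hCHc, hlow, hssc, hstar, hstarH⟩ := h
  have hC : ∀ {a}, a ∈ CH ∪ CL → (worldsOf Cn (star a)).Nonempty := fun {a} ha =>
    (consistent_iff_nonempty hCn).1 (hs.consistency a (ha.elim (hCHc a) (hCLc a)))
  have hss : ∀ a, worldsOf Cn (star a) ⊆ worldsOfForm Cn a := fun a M hM =>
    (mem_worldsOfForm hCn).2 (hM (hs.success a))
  have hneg : ∀ {a b}, Form.neg a ∉ star b ↔ (worldsOf Cn (star b) ∩ worldsOfForm Cn a).Nonempty :=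
    fun {a b} => neg_notMem_iff hCn (hs.closure b)
  have hor : ∀ {a b}, worldsOfForm Cn a ⊆ worldsOfForm Cn b → star b = star (Form.or a b) :=
    fun {a b} hab => hs.extensionality _ _ <| (thm_iff_iff hCn).2 <| by
      rw [worldsOfForm_or hCn, Set.union_eq_right.2 hab]
  have hsuper : ∀ {a b x}, worldsOfForm Cn a ⊆ worldsOfForm Cn b → x ∈ star a →
      Form.imp a x ∈ star b := by
    intro a b x hab hx
    obtain ⟨c, hc, hac⟩ := exists_diff hCn hab
    have hbc : star (Form.or a c) = star b := hs.extensionality _ _ ((thm_iff_iff hCn).2 hac)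
    rw [← hbc]
    refine hs.disjunctiveOverlap a c ⟨?_, ?_⟩
    · rw [hs.closure a]
      exact (mem_Cn_iff hCn).2 fun M hM => (M.imp_mem_iff hCn).2 fun _ => hM hx
    · rw [hs.closure c]
      exact (mem_Cn_iff hCn).2 fun M hM => (M.imp_mem_iff hCn).2 fun haM =>
        absurd haM (hc M (hM (hs.success c)))
  have hcen : ∀ {a}, (worldsOf Cn K ∩ worldsOfForm Cn a).Nonempty → star a = expand Cn K a :=
    fun {a} ha => (hs.inclusion a).antisymm (hs.vacuity a ((neg_notMem_iff hCn hK).2 ha))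
  have hcenH : ∀ {a}, (worldsOf Cn K ∩ worldsOfForm Cn a).Nonempty → a ∈ CH := by
    intro a ha
    by_contra haH
    -- Revising by the tautology `a → a`, which belongs to `K`, returns `K`.
    have ht : Form.imp a a ∈ K := by
      rw [hK]; exact hCn.supraclassicality _ _ fun v _ => id
    refine (neg_notMem_iff hCn hK).2 ha ?_
    have hx := hs.inclusion _ (hstarH a _ haH (hlow hKc ht))
    rw [mem_expand_iff hCn] at hx
    rw [hK]
    exact (mem_Cn_iff hCn).2 fun M hM => hx M hM (hM ht)
  refine ⟨fun a => {M | a ∈ CH ∪ CL ∧ M ∈ worldsOf Cn (star a)}, CH, ?_, ?_, ?_, ?_, ?_, ?_, ?_,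
    ?_, ?_, ?_⟩
  · exact fun a M hM => hss a hM.2
  · rintro a b hab ⟨M, ha, hM⟩
    have hb : b ∈ CH ∪ CL := by
      by_contra hb
      exact (M.neg_mem_iff hCn).1 (hM (hstar b a hb ha)) ((mem_worldsOfForm hCn).1 (hab (hss a hM)))
    obtain ⟨N, hN⟩ := hC hb
    exact ⟨N, hb, hN⟩
  · rintro a b hab ⟨M, ⟨hb, hM⟩, hMa⟩
    have hn : Form.neg a ∉ star b := hneg.2 ⟨M, hM, hMa⟩
    have ha : a ∈ CH ∪ CL := by
      by_contra ha
      exact hn (hstar a b ha hb)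
    have hsub : star b ⊆ star a := by
      rw [hor hab] at hn ⊢
      exact hs.disjunctiveInclusion a b hn
    ext N
    refine ⟨fun hN => ⟨⟨hb, hsub.trans hN.2⟩, hss a hN.2⟩, fun hN => ⟨ha, fun x hx => ?_⟩⟩
    exact (N.imp_mem_iff hCn).1 (hN.1.2 (hsuper hab hx)) ((mem_worldsOfForm hCn).1 hN.2)
  · intro a ha
    obtain ⟨N, hN⟩ := hC (Or.inl ha)
    exact ⟨N, Or.inl ha, hN⟩
  · exact fun a b hab ha => hssc a ha ((mem_Cn_singleton_iff hCn).2 hab)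
  · rintro a b hab ⟨M, ⟨_, hM⟩, hMa⟩ hb
    by_contra ha
    exact hneg.2 ⟨M, hM, hMa⟩ (hstarH a b ha hb)
  · intro a ha
    ext M
    constructor
    · rintro ⟨-, hM⟩
      refine ⟨fun x hx => hM ?_, hss a hM⟩
      rw [hcen ha]
      exact (mem_expand_iff hCn).2 fun N hN _ => hN hx
    · intro hM
      refine ⟨Or.inl (hcenH ha), fun x hx => ?_⟩
      rw [hcen ha] at hx
      exact (mem_expand_iff hCn).1 hx M hM.1 ((mem_worldsOfForm hCn).1 hM.2)
  · exact fun a ha => hcenH ha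
  · intro a ha
    have : {M | a ∈ CH ∪ CL ∧ M ∈ worldsOf Cn (star a)} = worldsOf Cn (star a) :=
      Set.ext fun M => and_iff_right (Or.inl ha)
    rw [this, theoryOf_worldsOf hCn (hs.closure a), hrev.high a ha]
  · intro a ha
    rw [theoryOf_union, theoryOf_worldsOf hCn hK]
    by_cases haL : a ∈ CL
    · have : {M | a ∈ CH ∪ CL ∧ M ∈ worldsOf Cn (star a)} = worldsOf Cn (star a) :=
        Set.ext fun M => and_iff_right (Or.inr haL)
      rw [this, theoryOf_worldsOf hCn (hs.closure a), hrev.low a haL, Set.inter_comm]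
    · have hn : a ∉ CL ∪ CH := fun h => h.elim haL ha
      rw [hrev.none a hn]
      exact (Set.inter_eq_left.2 fun x _ M hM => absurd hM.1.symm hn).symm

end BeliefRevision

theorem theorem1 {Atom : Type*}
    (Cn : Set (BeliefRevision.Form Atom) → Set (BeliefRevision.Form Atom))
    (hCn : BeliefRevision.IsConsequence Cn)
    (K : Set (BeliefRevision.Form Atom))
    (hK_closed : K = Cn K)
    (hK_consistent : BeliefRevision.Consistent Cn K)
    (rev : BeliefRevision.Form Atom → Set (BeliefRevision.Form Atom)) :
    List.TFAE [
      BeliefRevision.WeakRelativeSuccess K rev ∧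
        BeliefRevision.Closure Cn rev ∧
        BeliefRevision.Inclusion Cn K rev ∧
        BeliefRevision.ConsistencyPreservation Cn K rev ∧
        BeliefRevision.Vacuity Cn K rev ∧
        BeliefRevision.Extensionality Cn rev ∧
        BeliefRevision.StrictImprovement Cn rev ∧
        BeliefRevision.NPersistence rev ∧
        BeliefRevision.NRecovery Cn K rev ∧
        BeliefRevision.DisjunctiveOverlap rev ∧
        BeliefRevision.DisjunctiveInclusion rev,
      BeliefRevision.IsSphereBasedTwoLevelCLRevision Cn K rev,
      ∃ (star : BeliefRevision.Form Atom → Set (BeliefRevision.Form Atom))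
        (CH CL : Set (BeliefRevision.Form Atom)),
        BeliefRevision.IsAGMRevision Cn K star ∧
        BeliefRevision.IsTwoLevelCLRevision Cn K star CH CL rev ∧
        BeliefRevision.CredibilityOfLogicalEquivalents Cn CL ∧
        BeliefRevision.ElementConsistency Cn CL ∧
        CH ∩ CL = ∅ ∧
        BeliefRevision.ElementConsistency Cn CH ∧
        BeliefRevision.CredibilityLowerBounding Cn K CH ∧
        BeliefRevision.SingleSentenceClosure Cn CH ∧
        BeliefRevision.CredStar (CH ∪ CL) star ∧
        BeliefRevision.CredStar CH star] := by
  have hpost : BeliefRevision.SatisfiesPostulates Cn K rev ↔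
      ∃ F H, BeliefRevision.IsTwoLevelChoice Cn K rev F H :=
    ⟨fun h => ⟨_, _, h.isTwoLevelChoice hCn hK_closed hK_consistent⟩,
      fun ⟨_, _, h⟩ => h.satisfiesPostulates hCn hK_closed hK_consistent⟩
  have hsph : BeliefRevision.IsSphereBasedTwoLevelCLRevision Cn K rev ↔
      ∃ F H, BeliefRevision.IsTwoLevelChoice Cn K rev F H :=
    ⟨fun ⟨_, _, hS, h⟩ => ⟨_, _, BeliefRevision.isTwoLevelChoice_of_spheres hCn hK_closed hS h⟩,
      fun ⟨_, _, h⟩ => h.exists_spheres hCn hK_closed hK_consistent⟩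
  have hagm : BeliefRevision.IsInducedByAGM Cn K rev ↔
      ∃ F H, BeliefRevision.IsTwoLevelChoice Cn K rev F H :=
    ⟨fun h => h.exists_isTwoLevelChoice hCn hK_closed hK_consistent,
      fun ⟨_, _, h⟩ => h.isInducedByAGM hCn hK_closed hK_consistent⟩
  tfae_have 1 ↔ 2 := hpost.trans hsph.symm
  tfae_have 2 ↔ 3 := hsph.trans hagm.symm
  tfae_finish
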